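/- Let $N\in\{3,4\}$, $2^*=\frac{2N}{N-2}$, $a,b>0$, $\alpha>1$, $\beta>1$ with $\alpha+\beta<2^*$, and let $\nu\le 0$. Let $H^1(\mathbb R^N)$ be the Sobolev space of real-valued functions. For $(u,v)\in H^1(\mathbb R^N)\times H^1(\mathbb R^N)$ put $$I_\nu(u,v)=\frac12\int_{\mathbb R^N}\big(|\nabla u|^2+|\nabla v|^2\big)-\frac1{2^*}\int_{\mathbb R^N}\big(|u|^{2^*}+|v|^{2^*}\big)-\nu\int_{\mathbb R^N}|u|^\alpha|v|^\beta,$$ $$P_\nu(u,v)=\int_{\mathbb R^N}\big(|\nabla u|^2+|\nabla v|^2\big)-\int_{\mathbb R^N}\big(|u|^{2^*}+|v|^{2^*}\big)-\nu\,\gamma_{\alpha+\beta}\int_{\mathbb R^N}|u|^\alpha|v|^\beta,\qquad \gamma_p=\frac{N(p-2)}2,$$ and let $$\mathcal P_\nu(a,b)=\Big\{(u,v)\in H^1(\mathbb R^N)\times H^1(\mathbb R^N):\ \int_{\mathbb R^N} u^2=a^2,\ \int_{\mathbb R^N} v^2=b^2,\ P_\nu(u,v)=0\Big\},\qquad m_\nu(a,b)=\inf_{\mathcal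 P_\nu(a,b)}I_\nu .$$ Then $\mathcal P_\nu(a,b)\neq\emptyset$ and $I_\nu$ is bounded below on it, so that $m_\nu(a,b)$ is a real number, but $m_\nu(a,b)$ is not achieved: there is no $(u,v)\in\mathcal P_\nu(a,b)$ with $I_\nu(u,v)=m_\nu(a,b)$. In particular, there is no normalized ground state, that is, no $(u,v)\in\mathcal P_\nu(a,b)$ with $I_\nu(u,v)=m_\nu(a,b)$ that is, for some $\lambda_1,\lambda_2\in\mathbb R$, a weak solution of $$-\Delta u+\lambda_1u=|u|^{2^*-2}u+\nu\alpha|u|^{\alpha-2}|v|^\beta u,\qquad -\Delta v+\lambda_2v=|v|^{2^*-2}v+\nu\beta|u|^\alpha|v|^{\beta-2}v\quad\text{in }\mathbb R^N .$$ -/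

import Mathlib

open MeasureTheory
open scoped ContDiff

/-- The Euclidean space `ℝᴺ`. -/
abbrev RN (N : ℕ) : Type := EuclideanSpace ℝ (Fin N)

/-- `G` is a weak (distributional) gradient of the real-valued function `u` on `ℝᴺ`:
`∫ u ∂ᵢφ = - ∫ φ Gᵢ` for all test functions `φ ∈ C_c^∞(ℝᴺ)` and all `i`. -/
def HasWeakGradient {N : ℕ} (u : RN N → ℝ) (G : RN N → RN N) : Prop :=
  ∀ φ : RN N → ℝ, ContDiff ℝ ∞ φ → HasCompactSupport φ → ∀ i : Fin N,
    ∫ x, u x * fderiv ℝ φ x (EuclideanSpace.single i 1) = - ∫ x, φ x * G x i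

/-- The Sobolev space `H¹(ℝᴺ)` of real-valued functions. An element is a square integrable function
together with a square integrable weak gradient. The gradient is determined almost everywhere by
the function, so every integral below depends only on the almost everywhere class of the function. -/
structure SobolevH1 (N : ℕ) where
  /-- the function -/
  toFun : RN N → ℝ
  /-- its weak gradient -/
  grad : RN N → RN N
  memLp_toFun : MemLp toFun 2 volume
  memLp_grad : MemLp grad 2 volume
  hasWeakGradient : HasWeakGradient toFun grad

instance (N : ℕ) : CoeFun (SobolevH1 N) (fun _ => RN N → ℝ) := ⟨SobolevH1.toFun⟩

noncomputable section

/-- The critical Sobolev exponent `2* = 2N / (N - 2)`. -/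
def critExp (N : ℕ) : ℝ := 2 * (N : ℝ) / ((N : ℝ) - 2)

/-- `γ_p = N (p - 2) / 2`. -/
def gammaExp (N : ℕ) (p : ℝ) : ℝ := (N : ℝ) * (p - 2) / 2

/-- The energy functional
`I_ν(u,v) = 1/2 ∫ (|∇u|² + |∇v|²) - 1/2* ∫ (|u|^{2*} + |v|^{2*}) - ν ∫ |u|^α |v|^β`. -/
def energy {N : ℕ} (α β ν : ℝ) (w : SobolevH1 N × SobolevH1 N) : ℝ :=
  1 / 2 * (∫ x, (‖w.1.grad x‖ ^ 2 + ‖w.2.grad x‖ ^ 2))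
    - 1 / critExp N * (∫ x, (|w.1 x| ^ critExp N + |w.2 x| ^ critExp N))
    - ν * ∫ x, |w.1 x| ^ α * |w.2 x| ^ β

/-- The Pohozaev functional
`P_ν(u,v) = ∫ (|∇u|² + |∇v|²) - ∫ (|u|^{2*} + |v|^{2*}) - ν γ_{α+β} ∫ |u|^α |v|^β`. -/
def pohozaev {N : ℕ} (α β ν : ℝ) (w : SobolevH1 N × SobolevH1 N) : ℝ :=
  (∫ x, (‖w.1.grad x‖ ^ 2 + ‖w.2.grad x‖ ^ 2))
    - (∫ x, (|w.1 x| ^ critExp N + |w.2 x| ^ critExp N))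
    - ν * gammaExp N (α + β) * ∫ x, |w.1 x| ^ α * |w.2 x| ^ β

/-- The `L²`-torus: pairs in `H¹ × H¹` with `∫ u² = a²` and `∫ v² = b²`. -/
def massTorus (N : ℕ) (a b : ℝ) : Set (SobolevH1 N × SobolevH1 N) :=
  {w | (∫ x, w.1 x ^ 2) = a ^ 2 ∧ (∫ x, w.2 x ^ 2) = b ^ 2}

/-- The Pohozaev set: pairs on the `L²`-torus with `P_ν(u,v) = 0`. -/
def pohozaevSet (N : ℕ) (α β ν a b : ℝ) : Set (SobolevH1 N × SobolevH1 N) :=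
  {w | w ∈ massTorus N a b ∧ pohozaev α β ν w = 0}

/-- The ground state level `m_ν(a,b)`, the infimum of `I_ν` over the Pohozaev set. -/
def groundLevel (N : ℕ) (α β ν a b : ℝ) : ℝ :=
  sInf (energy α β ν '' pohozaevSet N α β ν a b)

/-- `(u,v)` is a weak solution of
`-Δu + l₁ u = |u|^{2*-2} u + ν α |u|^{α-2} |v|^β u`,
`-Δv + l₂ v = |v|^{2*-2} v + ν β |u|^α |v|^{β-2} v` in `ℝᴺ`. -/
def IsWeakSolution {N : ℕ} (α β ν l₁ l₂ : ℝ) (w : SobolevH1 N × SobolevH1 N) : Prop :=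
  ∀ φ : RN N → ℝ, ContDiff ℝ ∞ φ → HasCompactSupport φ →
    ((∫ x, inner ℝ (w.1.grad x) (gradient φ x)) + l₁ * (∫ x, w.1 x * φ x)
      = (∫ x, |w.1 x| ^ (critExp N - 2) * w.1 x * φ x)
        + ν * α * ∫ x, |w.1 x| ^ (α - 2) * |w.2 x| ^ β * w.1 x * φ x) ∧
    ((∫ x, inner ℝ (w.2.grad x) (gradient φ x)) + l₂ * (∫ x, w.2 x * φ x)
      = (∫ x, |w.2 x| ^ (critExp N - 2) * w.2 x * φ x)
        + ν * β * ∫ x, |w.1 x| ^ α * |w.2 x| ^ (β - 2) * w.2 x * φ x)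

/-- A normalized ground state: an element of the Pohozaev set (in particular with the prescribed
masses) that solves the system for some real Lagrange multipliers and achieves `m_ν(a,b)`. -/
def IsNormalizedGroundState {N : ℕ} (α β ν a b : ℝ) (w : SobolevH1 N × SobolevH1 N) : Prop :=
  w ∈ pohozaevSet N α β ν a b ∧ (∃ l₁ l₂ : ℝ, IsWeakSolution α β ν l₁ l₂ w) ∧
    energy α β ν w = groundLevel N α β ν a b

end

/-! Every element of the Pohozaev set is beaten by another one. Let D and C be the total Dirichlet
and critical integrals of such a pair, and q = 2*/2 > 1. Since ν ≤ 0 and 0 ≤ γ < 2*, the constraint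
gives D ≤ C and energy at least D/N (`dirichlet_le_of_mem_pohozaevSet`). Put κ = C/D^q. Both masses
are positive, so both Dirichlet integrals are (`SobolevH1.dirichlet_pos`), and strict
superadditivity of t ↦ t^q forces one component to have κ D_i^q < C_i.

A single function with this strict inequality yields a competitor (`exists_mem_pohozaevSet`): cut it
off, normalise its mass, and place the other mass far away in a very flat profile of negligible
Dirichlet integral. Disjoint supports kill the coupling, and a mass-preserving dilation reaches the
Pohozaev set, with energy D'/N and κ D'^q < D'. As D ≤ C, this forces D' < D.

Neither the Sobolev inequality nor its extremals enter. -/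

open Filter Topology

/-! ### Test functions and their gradients -/

section TestFunctions

variable {N : ℕ} {φ : RN N → ℝ}

theorem continuous_gradient_of_contDiff (hφ : ContDiff ℝ ∞ φ) : Continuous (gradient φ) :=
  (InnerProductSpace.toDual ℝ (RN N)).symm.continuous.comp (hφ.continuous_fderiv (by simp))

theorem hasCompactSupport_gradient (hc : HasCompactSupport φ) :
    HasCompactSupport (gradient φ) :=
  (hc.fderiv ℝ).comp_left (g := (InnerProductSpace.toDual ℝ (RN N)).symm) (map_zero _)

theorem gradient_apply_eq_fderiv (φ : RN N → ℝ) (x : RN N) (i : Fin N) :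
    gradient φ x i = fderiv ℝ φ x (EuclideanSpace.single i 1) := by
  rw [← inner_gradient_left, EuclideanSpace.inner_single_right]
  simp

theorem continuous_fderiv_apply_of_contDiff (hφ : ContDiff ℝ ∞ φ) (v : RN N) :
    Continuous fun x => fderiv ℝ φ x v :=
  (hφ.continuous_fderiv (by simp)).clm_apply continuous_const

theorem hasCompactSupport_fderiv_apply (hc : HasCompactSupport φ) (v : RN N) :
    HasCompactSupport fun x => fderiv ℝ φ x v :=
  (hc.fderiv ℝ).comp_left (g := fun L : RN N →L[ℝ] ℝ => L v) (by simp)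

theorem hasWeakGradient_of_contDiff (hφ : ContDiff ℝ ∞ φ) :
    HasWeakGradient φ (gradient φ) := by
  intro ψ hψ hcψ i
  rw [integral_mul_fderiv_eq_neg_fderiv_mul_of_integrable]
  · congr 1
    refine integral_congr_ae (Eventually.of_forall fun x => ?_)
    simp only [gradient_apply_eq_fderiv]
    ring
  · exact ((continuous_fderiv_apply_of_contDiff hφ _).mul hψ.continuous).integrable_of_hasCompactSupport
      hcψ.mul_left
  · exact (hφ.continuous.mul (continuous_fderiv_apply_of_contDiff hψ _)).integrable_of_hasCompactSupport
      (hasCompactSupport_fderiv_apply hcψ _).mul_left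
  · exact (hφ.continuous.mul hψ.continuous).integrable_of_hasCompactSupport hcψ.mul_left
  · exact fun x _ => (hφ.differentiable (by simp)).differentiableAt
  · exact fun x _ => (hψ.differentiable (by simp)).differentiableAt

end TestFunctions

/-! ### An H¹ function with zero gradient vanishes -/

namespace SobolevH1

variable {N : ℕ}

/-- A test function as an element of `H¹`. -/
noncomputable def ofTest (φ : RN N → ℝ) (hφ : ContDiff ℝ ∞ φ) (hc : HasCompactSupport φ) :
    SobolevH1 N where
  toFun := φ
  grad := gradient φ
  memLp_toFun := hφ.continuous.memLp_of_hasCompactSupport hc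
  memLp_grad := (continuous_gradient_of_contDiff hφ).memLp_of_hasCompactSupport
    (hasCompactSupport_gradient hc)
  hasWeakGradient := hasWeakGradient_of_contDiff hφ

/-- The mass `∫ u²`. -/
noncomputable def mass (u : SobolevH1 N) : ℝ := ∫ x, u x ^ 2

/-- The Dirichlet integral `∫ |∇u|²`. -/
noncomputable def dirichlet (u : SobolevH1 N) : ℝ := ∫ x, ‖u.grad x‖ ^ 2

/-- The critical integral `∫ |u|^{2*}`. -/
noncomputable def critical (u : SobolevH1 N) : ℝ := ∫ x, |u x| ^ critExp N

theorem integrable_sq (u : SobolevH1 N) : Integrable fun x => u x ^ 2 :=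
  (memLp_two_iff_integrable_sq u.memLp_toFun.1).1 u.memLp_toFun

theorem integrable_norm_grad_sq (u : SobolevH1 N) : Integrable fun x => ‖u.grad x‖ ^ 2 :=
  (memLp_two_iff_integrable_sq_norm u.memLp_grad.1).1 u.memLp_grad

theorem aestronglyMeasurable_abs_rpow (u : SobolevH1 N) (p : ℝ) :
    AEStronglyMeasurable (fun x => |u x| ^ p) volume :=
  (u.memLp_toFun.1.aemeasurable.abs.pow_const p).aestronglyMeasurable

theorem dirichlet_nonneg (u : SobolevH1 N) : 0 ≤ u.dirichlet :=
  integral_nonneg fun _ => by positivity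

theorem locallyIntegrable (u : SobolevH1 N) : LocallyIntegrable u.toFun volume :=
  u.memLp_toFun.locallyIntegrable (by norm_num)

theorem mass_pos_of_critical_pos (u : SobolevH1 N) (hp : critExp N ≠ 0) (h : 0 < u.critical) :
    0 < u.mass := by
  refine lt_of_le_of_ne (integral_nonneg fun _ => by positivity) fun h0 => h.ne' ?_
  have := (integral_eq_zero_iff_of_nonneg (fun _ => by positivity) u.integrable_sq).1 h0.symm
  refine integral_eq_zero_of_ae ?_
  filter_upwards [this] with x hx
  have hx' : u x = 0 := by simpa using hx
  simp [hx', hp]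

/-- The local masses of an `L²` function tend to zero at infinity. -/
theorem tendsto_setIntegral_sq_ball (u : SobolevH1 N) (R : ℝ) {y : ℕ → RN N}
    (hy : Tendsto (fun n => ‖y n‖) atTop atTop) :
    Tendsto (fun n => ∫ x, (Metric.ball (y n) R).indicator (fun x => u x ^ 2) x) atTop (𝓝 0) := by
  have : Tendsto (fun n => ∫ x, (Metric.ball (y n) R).indicator (fun x => u x ^ 2) x) atTop
      (𝓝 (∫ _ : RN N, (0 : ℝ))) := by
    refine tendsto_integral_of_dominated_convergence (fun x => u x ^ 2)
      (fun n => u.integrable_sq.1.indicator Metric.isOpen_ball.measurableSet) u.integrable_sq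
      (fun n => Eventually.of_forall fun x => ?_) (Eventually.of_forall fun x => ?_)
    · rw [Real.norm_eq_abs, abs_of_nonneg (Set.indicator_nonneg (fun _ _ => by positivity) _)]
      exact Set.indicator_le_self' (fun _ _ => by positivity) _
    · refine tendsto_const_nhds.congr' ?_
      filter_upwards [hy.eventually_ge_atTop (‖x‖ + R)] with n hn
      rw [Set.indicator_of_notMem]
      rw [Metric.mem_ball, dist_eq_norm, not_lt]
      have := norm_sub_norm_le (y n) x
      rw [norm_sub_rev] at this
      linarith
  simpa using this

/-- If the weak gradient of `u` vanishes, then so do the derivatives of `u ⋆ φ`. -/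
theorem integral_mul_comp_sub_const (u : SobolevH1 N) (hu : u.grad =ᵐ[volume] 0) {φ : RN N → ℝ}
    (hφ : ContDiff ℝ ∞ φ) (hc : HasCompactSupport φ) (y z : RN N) :
    ∫ x, u x * φ (y - x) = ∫ x, u x * φ (z - x) := by
  set L := ContinuousLinearMap.mul ℝ ℝ
  have hder := fun x => hc.hasFDerivAt_convolution_right L u.locallyIntegrable
    (hφ.of_le (by simp)) x
  -- Up to sign, each partial derivative of u ⋆ φ at x pairs u with a derivative of the test
  -- function t ↦ φ(x - t); the weak gradient identity turns this into a pairing with the zero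
  -- gradient.
  have hz : ∀ x, fderiv ℝ (convolution u.toFun φ L volume) x = 0 := by
    intro x
    rw [(hder x).fderiv]
    refine ContinuousLinearMap.coe_injective
      ((EuclideanSpace.basisFun (Fin N) ℝ).toBasis.ext fun i => ?_)
    simp only [OrthonormalBasis.coe_toBasis, EuclideanSpace.basisFun_apply,
      ContinuousLinearMap.coe_coe]
    have hce : ConvolutionExistsAt u.toFun (fderiv ℝ φ) x (L.precompR (RN N)) volume :=
      ((hc.fderiv ℝ).convolutionExists_right _ u.locallyIntegrable
        (hφ.continuous_fderiv (by simp))) x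
    rw [convolution_def, ContinuousLinearMap.integral_apply hce]
    have hψ : ContDiff ℝ ∞ fun t => φ (x - t) := hφ.comp (contDiff_const.sub contDiff_id)
    have hcψ : HasCompactSupport fun t => φ (x - t) :=
      hc.comp_homeomorph (Homeomorph.subLeft x)
    have h := u.hasWeakGradient _ hψ hcψ i
    have h0 : ∫ t, φ (x - t) * u.grad t i = 0 := by
      refine integral_eq_zero_of_ae ?_
      filter_upwards [hu] with t ht
      simp [ht]
    rw [h0, neg_zero] at h
    refine neg_eq_zero.1 ?_
    rw [← integral_neg]
    simp only [ContinuousLinearMap.precompR_apply, L]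
    refine Eq.trans ?_ h
    refine integral_congr_ae (Eventually.of_forall fun t => ?_)
    have hd : HasFDerivAt (fun t => φ (x - t)) (-(fderiv ℝ φ (x - t))) t := by
      have e : -(fderiv ℝ φ (x - t)) = fderiv ℝ φ (x - t) ∘L
          (-(ContinuousLinearMap.id ℝ (RN N))) := by
        ext
        simp
      rw [e]
      exact ((hφ.differentiable (by simp)).differentiableAt (x := x - t)).hasFDerivAt.comp t
        ((hasFDerivAt_id t).const_sub x)
    simp [hd.fderiv]
  have := is_const_of_fderiv_eq_zero (fun x => (hder x).differentiableAt) hz y z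
  simpa [convolution_def, L] using this

/-- Young's inequality with weight δ. It separates the local mass of u, which is lost at infinity,
from the norm of ψ, which translations preserve. -/
theorem abs_integral_mul_le_of_support_subset_ball (u : SobolevH1 N) {ψ : RN N → ℝ} {y : RN N}
    {R : ℝ} (hψ : Integrable fun x => ψ x ^ 2) (hs : ∀ x, x ∉ Metric.ball y R → ψ x = 0) {δ : ℝ}
    (hδ : 0 < δ) :
    |∫ x, u x * ψ x| ≤ δ⁻¹ / 2 * (∫ x, (Metric.ball y R).indicator (fun x => u x ^ 2) x)
      + δ / 2 * ∫ x, ψ x ^ 2 := by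
  have hi1 : Integrable fun x => (Metric.ball y R).indicator (fun x => u x ^ 2) x :=
    u.integrable_sq.indicator Metric.isOpen_ball.measurableSet
  rw [← integral_const_mul, ← integral_const_mul,
    ← integral_add (hi1.const_mul _) (hψ.const_mul _), ← Real.norm_eq_abs]
  refine norm_integral_le_of_norm_le ((hi1.const_mul _).add (hψ.const_mul _))
    (Eventually.of_forall fun x => ?_)
  rw [Real.norm_eq_abs, abs_mul]
  by_cases hx : x ∈ Metric.ball y R
  · rw [Set.indicator_of_mem hx]
    have h2 : δ⁻¹ / 2 * u x ^ 2 + δ / 2 * ψ x ^ 2 - |u x| * |ψ x|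
        = δ⁻¹ / 2 * (|u x| - δ * |ψ x|) ^ 2 := by
      rw [← sq_abs (u x), ← sq_abs (ψ x)]
      field_simp
      ring
    have h3 : 0 ≤ δ⁻¹ / 2 * (|u x| - δ * |ψ x|) ^ 2 := by positivity
    linarith
  · rw [hs x hx, Set.indicator_of_notMem hx]
    simp

/-- The convolution u ⋆ φ is constant, so its value at 0 can be computed at points going to
infinity, where u has vanishing local mass. -/
theorem integral_mul_eq_zero_of_grad_ae_eq_zero (hN : 0 < N) (u : SobolevH1 N)
    (hu : u.grad =ᵐ[volume] 0) {φ : RN N → ℝ} (hφ : ContDiff ℝ ∞ φ) (hc : HasCompactSupport φ) :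
    ∫ x, u x * φ (0 - x) = 0 := by
  obtain ⟨R, hR⟩ := hc.isBounded.subset_ball 0
  obtain ⟨y, hy⟩ : ∃ y : ℕ → RN N, Tendsto (fun n => ‖y n‖) atTop atTop :=
    ⟨fun n => EuclideanSpace.single (⟨0, hN⟩ : Fin N) (n : ℝ), by
      simpa using tendsto_natCast_atTop_atTop (R := ℝ)⟩
  have hlim := u.tendsto_setIntegral_sq_ball R hy
  have hφ2 : Integrable fun x => φ x ^ 2 :=
    (memLp_two_iff_integrable_sq hφ.continuous.aestronglyMeasurable).1
      (hφ.continuous.memLp_of_hasCompactSupport hc)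
  have hK : 0 ≤ ∫ x, φ x ^ 2 := integral_nonneg fun _ => by positivity
  have bound : ∀ δ > 0, ∀ n, |∫ x, u x * φ (0 - x)| ≤
      δ⁻¹ / 2 * (∫ x, (Metric.ball (y n) R).indicator (fun x => u x ^ 2) x)
        + δ / 2 * ∫ x, φ x ^ 2 := by
    intro δ hδ n
    rw [u.integral_mul_comp_sub_const hu hφ hc 0 (y n),
      ← integral_sub_left_eq_self (fun x => φ x ^ 2) volume (y n)]
    refine u.abs_integral_mul_le_of_support_subset_ball (hφ2.comp_sub_left (y n))
      (fun x hx => ?_) hδ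
    by_contra hne
    have := hR (subset_tsupport _ (Function.mem_support.2 hne))
    apply hx
    rwa [mem_ball_zero_iff, norm_sub_rev, ← dist_eq_norm] at this
  generalize (∫ x, u x * φ (0 - x)) = c at bound ⊢
  generalize (∫ x, φ x ^ 2) = K at bound hK
  -- Send n to infinity with δ fixed; only afterwards let δ tend to 0.
  have key : ∀ δ > 0, |c| ≤ δ / 2 * K := by
    intro δ hδ
    have := (hlim.const_mul (δ⁻¹ / 2)).add_const (δ / 2 * K)
    rw [mul_zero, zero_add] at this
    exact ge_of_tendsto' this (bound δ hδ)
  have : |c| ≤ 0 := by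
    refine le_of_forall_pos_le_add fun ε hε => ?_
    have := key (ε / (K + 1)) (by positivity)
    have h2 : ε / (K + 1) / 2 * K ≤ ε := by
      rw [div_div, div_mul_eq_mul_div, div_le_iff₀ (by positivity)]
      nlinarith
    linarith
  exact abs_nonpos_iff.1 this

theorem ae_eq_zero_of_grad_ae_eq_zero (hN : 0 < N) (u : SobolevH1 N)
    (hu : u.grad =ᵐ[volume] 0) : u.toFun =ᵐ[volume] 0 := by
  refine ae_eq_zero_of_integral_contDiff_smul_eq_zero u.locallyIntegrable fun ψ hψ hcψ => ?_
  have := u.integral_mul_eq_zero_of_grad_ae_eq_zero hN hu (φ := fun x => ψ (-x))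
    (hψ.comp contDiff_neg) (hcψ.comp_homeomorph (Homeomorph.neg _))
  simpa [mul_comm] using this

theorem dirichlet_pos (hN : 0 < N) (u : SobolevH1 N) (hu : 0 < u.mass) : 0 < u.dirichlet := by
  refine lt_of_le_of_ne u.dirichlet_nonneg fun h0 => hu.ne' ?_
  have := (integral_eq_zero_iff_of_nonneg (fun _ => by positivity) u.integrable_norm_grad_sq).1
    h0.symm
  have hg : u.grad =ᵐ[volume] 0 := by
    filter_upwards [this] with x hx
    simpa using hx
  refine integral_eq_zero_of_ae ?_
  filter_upwards [u.ae_eq_zero_of_grad_ae_eq_zero hN hg] with x hx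
  simp [hx]

end SobolevH1

/-! ### Dilations and products with test functions -/

namespace SobolevH1

variable {N : ℕ}

theorem memLp_comp_smul {F : Type*} [NormedAddCommGroup F] {f : RN N → F} (hf : MemLp f 2 volume)
    {r : ℝ} (hr : r ≠ 0) : MemLp (fun x => f (r • x)) 2 volume := by
  refine MemLp.comp_of_map (g := f) (f := fun x : RN N => r • x) ?_
    (continuous_const_smul r).aemeasurable
  rw [Measure.map_addHaar_smul volume hr]
  exact hf.smul_measure ENNReal.ofReal_ne_top

/-- The rescaled function `c u(r x)`. -/
noncomputable def rescale (u : SobolevH1 N) (c r : ℝ) (hr : 0 < r) : SobolevH1 N where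
  toFun x := c * u (r • x)
  grad x := (c * r) • u.grad (r • x)
  memLp_toFun := (memLp_comp_smul u.memLp_toFun hr.ne').const_mul c
  memLp_grad := (memLp_comp_smul u.memLp_grad hr.ne').const_smul (c * r)
  hasWeakGradient := by
    intro φ hφ hc i
    have hψ : ContDiff ℝ ∞ fun y => φ (r⁻¹ • y) := hφ.comp (contDiff_const_smul _)
    have hcψ : HasCompactSupport fun y => φ (r⁻¹ • y) :=
      hc.comp_homeomorph (Homeomorph.smulOfNeZero r⁻¹ (inv_ne_zero hr.ne'))
    have h := u.hasWeakGradient _ hψ hcψ i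
    have e1 := Measure.integral_comp_smul volume (fun y => u y *
      fderiv ℝ (fun y => φ (r⁻¹ • y)) y (EuclideanSpace.single i 1)) r
    have e2 := Measure.integral_comp_smul volume (fun y => φ (r⁻¹ • y) * u.grad y i) r
    rw [h, smul_neg, ← e2] at e1
    simp only [fderiv_comp_smul, smul_smul, inv_mul_cancel₀ hr.ne', one_smul] at e1
    have e3 : ∫ x, c * u (r • x) * fderiv ℝ φ x (EuclideanSpace.single i 1)
        = (c * r) * ∫ x, u (r • x) *
          (r⁻¹ • fderiv ℝ φ x : RN N →L[ℝ] ℝ) (EuclideanSpace.single i 1) := by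
      rw [← integral_const_mul]
      refine integral_congr_ae (Eventually.of_forall fun x => ?_)
      simp only [_root_.smul_apply, smul_eq_mul]
      field_simp
    rw [e3, e1, mul_neg, ← integral_const_mul]
    congr 1
    refine integral_congr_ae (Eventually.of_forall fun x => ?_)
    simp only [PiLp.smul_apply, smul_eq_mul]
    ring

theorem integral_comp_smul_rpow (f : RN N → ℝ) {r : ℝ} (hr : 0 < r) :
    ∫ x, f (r • x) = r ^ (-(N : ℝ)) * ∫ x, f x := by
  rw [Measure.integral_comp_smul]
  simp only [finrank_euclideanSpace, Fintype.card_fin, smul_eq_mul]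
  rw [abs_of_nonneg (by positivity), Real.rpow_neg hr.le, Real.rpow_natCast]

variable (u : SobolevH1 N) (c : ℝ) {r : ℝ} (hr : 0 < r)

theorem mass_rescale : (u.rescale c r hr).mass = c ^ 2 * r ^ (-(N : ℝ)) * u.mass := by
  simp only [mass, rescale, mul_pow, integral_const_mul]
  rw [integral_comp_smul_rpow (fun x => u x ^ 2) hr]
  ring

theorem dirichlet_rescale :
    (u.rescale c r hr).dirichlet = c ^ 2 * r ^ (2 - (N : ℝ)) * u.dirichlet := by
  simp only [dirichlet, rescale, norm_smul, mul_pow, integral_const_mul]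
  rw [integral_comp_smul_rpow (fun x => ‖u.grad x‖ ^ 2) hr, sub_eq_add_neg, Real.rpow_add hr,
    Real.rpow_two, Real.norm_eq_abs, sq_abs]
  ring

theorem critical_rescale :
    (u.rescale c r hr).critical = |c| ^ critExp N * r ^ (-(N : ℝ)) * u.critical := by
  simp only [critical, rescale, abs_mul, Real.mul_rpow (abs_nonneg _) (abs_nonneg _),
    integral_const_mul]
  rw [integral_comp_smul_rpow (fun x => |u x| ^ critExp N) hr]
  ring

/-- The product of an `H¹` function with a test function. -/
noncomputable def mulTest (χ : RN N → ℝ) (hχ : ContDiff ℝ ∞ χ) (hc : HasCompactSupport χ) :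
    SobolevH1 N where
  toFun x := χ x * u x
  grad x := χ x • u.grad x + u x • gradient χ x
  memLp_toFun := u.memLp_toFun.mul (hχ.continuous.memLp_of_hasCompactSupport (p := ⊤) hc)
  memLp_grad := (u.memLp_grad.smul (hχ.continuous.memLp_of_hasCompactSupport (p := ⊤) hc)).add
    (((continuous_gradient_of_contDiff hχ).memLp_of_hasCompactSupport (p := ⊤)
      (hasCompactSupport_gradient hc)).smul u.memLp_toFun)
  hasWeakGradient := by
    intro φ hφ hcφ i
    -- Testing u against χφ produces the product rule for χu.
    have h := u.hasWeakGradient (fun x => χ x * φ x) (hχ.mul hφ) hcφ.mul_left i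
    have hint : ∀ g : RN N → ℝ, Continuous g → HasCompactSupport g →
        Integrable fun x => u x * g x := fun g hg hcg =>
      (u.memLp_toFun.integrable_mul (hg.memLp_of_hasCompactSupport (p := 2) hcg))
    have hint' : ∀ g : RN N → ℝ, Continuous g → HasCompactSupport g →
        Integrable fun x => g x * u.grad x i := fun g hg hcg =>
      ((hg.memLp_of_hasCompactSupport (p := 2) hcg).integrable_mul
        (((EuclideanSpace.proj i : RN N →L[ℝ] ℝ).comp_memLp' u.memLp_grad)))
    have i1 := hint (fun x => χ x * fderiv ℝ φ x (EuclideanSpace.single i 1))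
      (hχ.continuous.mul (continuous_fderiv_apply_of_contDiff hφ _)) hc.mul_right
    have i2 := hint (fun x => φ x * fderiv ℝ χ x (EuclideanSpace.single i 1))
      (hφ.continuous.mul (continuous_fderiv_apply_of_contDiff hχ _)) hcφ.mul_right
    have i3 := hint' (fun x => χ x * φ x) (hχ.continuous.mul hφ.continuous) hcφ.mul_left
    have e1 : ∫ x, u x * fderiv ℝ (fun x => χ x * φ x) x (EuclideanSpace.single i 1)
        = (∫ x, u x * (χ x * fderiv ℝ φ x (EuclideanSpace.single i 1)))
          + ∫ x, u x * (φ x * fderiv ℝ χ x (EuclideanSpace.single i 1)) := by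
      rw [← integral_add i1 i2]
      refine integral_congr_ae (Eventually.of_forall fun x => ?_)
      simp only
      rw [fderiv_fun_mul (hχ.differentiable (by simp)).differentiableAt
        (hφ.differentiable (by simp)).differentiableAt]
      simp [mul_add]
    have e2 : ∫ x, φ x * (χ x • u.grad x + u x • gradient χ x) i
        = (∫ x, χ x * φ x * u.grad x i)
          + ∫ x, u x * (φ x * fderiv ℝ χ x (EuclideanSpace.single i 1)) := by
      rw [← integral_add i3 i2]
      refine integral_congr_ae (Eventually.of_forall fun x => ?_)
      simp only [PiLp.add_apply, PiLp.smul_apply, smul_eq_mul, gradient_apply_eq_fderiv]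
      ring
    rw [e2, neg_add, ← h, e1, add_neg_cancel_right]
    refine integral_congr_ae (Eventually.of_forall fun x => ?_)
    simp only
    ring

end SobolevH1

/-! ### Cut-offs and pairs with disjoint supports -/

namespace SobolevH1

variable {N : ℕ}

/-- The integral of a non-integrable function is 0 by convention, so positivity supplies
integrability without Sobolev embedding. -/
theorem integrable_of_critical_pos (u : SobolevH1 N) (h : 0 < u.critical) :
    Integrable fun x => |u x| ^ critExp N := by
  by_contra hn
  exact h.ne' (integral_undef hn)

theorem norm_gradient_le_of_comp_smul {χ : RN N → ℝ} {K : ℝ} (hK : ∀ x, ‖fderiv ℝ χ x‖ ≤ K)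
    {s : ℝ} (hs : 0 ≤ s) (x : RN N) : ‖gradient (fun y => χ (s • y)) x‖ ≤ s * K := by
  simp only [gradient, LinearIsometryEquiv.norm_map, fderiv_comp_smul, norm_smul, Real.norm_eq_abs,
    abs_of_nonneg hs]
  exact mul_le_mul_of_nonneg_left (hK _) hs

theorem contDiff_comp_smul {χ : RN N → ℝ} (hχ : ContDiff ℝ ∞ χ) (s : ℝ) :
    ContDiff ℝ ∞ fun y : RN N => χ (s • y) :=
  hχ.comp (contDiff_const_smul s)

theorem hasCompactSupport_comp_smul {χ : RN N → ℝ} (hc : HasCompactSupport χ) {s : ℝ}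
    (hs : s ≠ 0) : HasCompactSupport fun y : RN N => χ (s • y) :=
  hc.comp_homeomorph (Homeomorph.smulOfNeZero s hs)

/-- Cutting off at large radii preserves the inequality `κ D^q < C`. -/
theorem exists_compact_support_critical_gt (hp : 0 < critExp N) {κ : ℝ} (u : SobolevH1 N)
    (hu : 0 < u.critical) (h : κ * u.dirichlet ^ (critExp N / 2) < u.critical) :
    ∃ z : SobolevH1 N, HasCompactSupport z.toFun ∧ 0 < z.critical ∧
      κ * z.dirichlet ^ (critExp N / 2) < z.critical := by
  obtain ⟨χ, hχ, hc, h0, h01⟩ : ∃ χ : RN N → ℝ, ContDiff ℝ ∞ χ ∧ HasCompactSupport χ ∧ χ 0 = 1 ∧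
      ∀ x, |χ x| ≤ 1 := by
    let f : ContDiffBump (0 : RN N) := ⟨1, 2, by norm_num, by norm_num⟩
    exact ⟨f, f.contDiff, f.hasCompactSupport, f.one_of_mem_closedBall (by simp [f.rIn_pos.le]),
      fun x => by rw [abs_of_nonneg f.nonneg]; exact f.le_one⟩
  obtain ⟨K, hK⟩ := (hc.fderiv ℝ).exists_bound_of_continuous (hχ.continuous_fderiv (by simp))
  have hK0 : 0 ≤ K := (norm_nonneg _).trans (hK 0)
  -- The bound s ≤ 1 makes the cut-off gradients uniformly bounded by K, as domination requires.
  obtain ⟨s, hs, hs1, hlim⟩ : ∃ s : ℕ → ℝ, (∀ n, 0 < s n) ∧ (∀ n, s n ≤ 1) ∧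
      Tendsto s atTop (𝓝 0) := by
    refine ⟨fun n => 1 / ((n : ℝ) + 1), fun n => by positivity, fun n => ?_,
      tendsto_one_div_add_atTop_nhds_zero_nat⟩
    rw [div_le_one (by positivity)]
    linarith [n.cast_nonneg (α := ℝ)]
  let z : ℕ → SobolevH1 N := fun n => u.mulTest (fun y => χ (s n • y))
    (contDiff_comp_smul hχ _) (hasCompactSupport_comp_smul hc (hs n).ne')
  have hχlim : ∀ x : RN N, Tendsto (fun n => χ (s n • x)) atTop (𝓝 1) := by
    intro x
    have := (hχ.continuous.tendsto 0).comp
      (by simpa using hlim.smul_const x : Tendsto (fun n => s n • x) atTop (𝓝 0))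
    rwa [h0] at this
  have hglim : ∀ x : RN N, Tendsto (fun n => gradient (fun y => χ (s n • y)) x) atTop (𝓝 0) := by
    intro x
    refine squeeze_zero_norm (fun n => norm_gradient_le_of_comp_smul hK (hs n).le x) ?_
    simpa using hlim.mul_const K
  have hD : Tendsto (fun n => (z n).dirichlet) atTop (𝓝 u.dirichlet) := by
    refine tendsto_integral_of_dominated_convergence
      (fun x => 2 * (‖u.grad x‖ ^ 2 + K ^ 2 * u x ^ 2))
      (fun n => (z n).integrable_norm_grad_sq.1)
      ((u.integrable_norm_grad_sq.add (u.integrable_sq.const_mul _)).const_mul 2)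
      (fun n => Eventually.of_forall fun x => ?_) (Eventually.of_forall fun x => ?_)
    · rw [Real.norm_eq_abs, abs_of_nonneg (by positivity)]
      have h1 : ‖χ (s n • x) • u.grad x‖ ≤ ‖u.grad x‖ := by
        rw [norm_smul]
        exact mul_le_of_le_one_left (norm_nonneg _) (h01 _)
      have h2 : ‖u x • gradient (fun y => χ (s n • y)) x‖ ≤ K * |u x| := by
        rw [norm_smul, mul_comm, Real.norm_eq_abs]
        refine mul_le_mul_of_nonneg_right ?_ (abs_nonneg _)
        exact (norm_gradient_le_of_comp_smul hK (hs n).le x).trans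
          (mul_le_of_le_one_left hK0 (hs1 n))
      have h3 : ‖(z n).grad x‖ ≤ ‖u.grad x‖ + K * |u x| :=
        (norm_add_le _ _).trans (add_le_add h1 h2)
      calc ‖(z n).grad x‖ ^ 2 ≤ (‖u.grad x‖ + K * |u x|) ^ 2 :=
            pow_le_pow_left₀ (norm_nonneg _) h3 2
        _ ≤ 2 * (‖u.grad x‖ ^ 2 + (K * |u x|) ^ 2) := add_sq_le
        _ = _ := by rw [mul_pow, sq_abs]
    · have := ((((hχlim x).smul_const (u.grad x)).add ((hglim x).const_smul (u x))).norm).pow 2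
      simpa [z, mulTest] using this
  have hC : Tendsto (fun n => (z n).critical) atTop (𝓝 u.critical) := by
    refine tendsto_integral_of_dominated_convergence (fun x => |u x| ^ critExp N)
      (fun n => (z n).aestronglyMeasurable_abs_rpow _) (u.integrable_of_critical_pos hu)
      (fun n => Eventually.of_forall fun x => ?_) (Eventually.of_forall fun x => ?_)
    · rw [Real.norm_eq_abs, abs_of_nonneg (by positivity)]
      refine Real.rpow_le_rpow (abs_nonneg _) ?_ hp.le
      change |χ (s n • x) * u x| ≤ |u x|
      rw [abs_mul]
      exact mul_le_of_le_one_left (abs_nonneg _) (h01 _)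
    · have := (((hχlim x).mul_const (u x)).abs).rpow_const (p := critExp N) (Or.inr hp.le)
      simpa [z, mulTest, abs_mul] using this
  have hκ : Tendsto (fun n => κ * (z n).dirichlet ^ (critExp N / 2)) atTop
      (𝓝 (κ * u.dirichlet ^ (critExp N / 2))) :=
    (hD.rpow_const (Or.inr (by positivity))).const_mul κ
  obtain ⟨n, hn1, hn2⟩ := ((hκ.eventually_lt hC h).and (hC.eventually_const_lt hu)).exists
  exact ⟨z n, (hasCompactSupport_comp_smul hc (hs n).ne').mul_right, hn2, hn1⟩

/-- There is a nontrivial `H¹` function supported outside a ball around the origin. -/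
theorem exists_critical_pos_support (hN : 0 < N) (hp : 0 < critExp N) :
    ∃ φ : SobolevH1 N, 0 < φ.critical ∧ ∀ x, φ x ≠ 0 → 1 ≤ ‖x‖ := by
  let f : ContDiffBump (EuclideanSpace.single (⟨0, hN⟩ : Fin N) (2 : ℝ) : RN N) :=
    ⟨1 / 2, 1, by norm_num, by norm_num⟩
  have hc : HasCompactSupport f := f.hasCompactSupport
  have hcont : Continuous fun x => |f x| ^ critExp N :=
    f.continuous.abs.rpow_const fun _ => Or.inr hp.le
  refine ⟨ofTest f f.contDiff hc, ?_, fun x hx => ?_⟩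
  · refine hcont.integral_pos_of_hasCompactSupport_nonneg_nonzero
      (hc.comp_left (g := fun t => |t| ^ critExp N) (by simp [hp.ne'])) (fun x => by positivity)
      (x := EuclideanSpace.single (⟨0, hN⟩ : Fin N) (2 : ℝ)) ?_
    have h1 : f (EuclideanSpace.single (⟨0, hN⟩ : Fin N) (2 : ℝ)) = 1 :=
      f.one_of_mem_closedBall (Metric.mem_closedBall_self f.rIn_pos.le)
    change |f _| ^ critExp N ≠ 0
    simp [h1]
  · have hx : x ∈ Function.support f := hx
    rw [f.support_eq, mem_ball_iff_norm] at hx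
    have h1 : ‖(EuclideanSpace.single (⟨0, hN⟩ : Fin N) (2 : ℝ) : RN N)‖ = 2 := by simp
    have h2 := norm_sub_norm_le (EuclideanSpace.single (⟨0, hN⟩ : Fin N) (2 : ℝ) : RN N) x
    rw [norm_sub_rev, h1] at h2
    have : ‖x - EuclideanSpace.single (⟨0, hN⟩ : Fin N) (2 : ℝ)‖ < 1 := hx
    linarith

/-- A pair with disjoint supports and prescribed masses, whose second component is so spread out
that the inequality `κ D^q < C` is inherited from a single function. -/
theorem exists_disjoint_pair (hN : 0 < N) (hp : 0 < critExp N) {a b : ℝ} (ha : 0 < a)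
    (hb : 0 < b) {κ : ℝ} (u : SobolevH1 N) (hu : 0 < u.critical)
    (h : κ * u.dirichlet ^ (critExp N / 2) < u.critical) :
    ∃ v w : SobolevH1 N, v.mass = a ^ 2 ∧ w.mass = b ^ 2 ∧ 0 < v.critical ∧ 0 < w.critical ∧
      (∀ x, v x = 0 ∨ w x = 0) ∧
      κ * (v.dirichlet + w.dirichlet) ^ (critExp N / 2) < v.critical + w.critical := by
  obtain ⟨z, hzc, hz, hκ⟩ := u.exists_compact_support_critical_gt hp hu h
  obtain ⟨φ, hφ, hφs⟩ := exists_critical_pos_support hN hp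
  have hzm := z.mass_pos_of_critical_pos hp.ne' hz
  have hφm := φ.mass_pos_of_critical_pos hp.ne' hφ
  obtain ⟨R, hR⟩ := hzc.isBounded.subset_ball 0
  set c := a / √z.mass
  have hc : 0 < c := by positivity
  set v := z.rescale c 1 one_pos with hv
  have hvm : v.mass = a ^ 2 := by
    rw [hv, mass_rescale, div_pow, Real.sq_sqrt hzm.le]
    simp [hzm.ne']
  have hvd : v.dirichlet = c ^ 2 * z.dirichlet := by
    rw [hv, dirichlet_rescale]
    simp
  have hvc : v.critical = c ^ critExp N * z.critical := by
    rw [hv, critical_rescale, abs_of_pos hc]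
    simp
  -- Multiplying the function by c scales both sides by c^{2*}.
  have hvκ : κ * v.dirichlet ^ (critExp N / 2) < v.critical := by
    have e : (c ^ 2) ^ (critExp N / 2) = c ^ critExp N := by
      rw [← Real.rpow_two, ← Real.rpow_mul hc.le]
      congr 1
      ring
    rw [hvd, hvc, Real.mul_rpow (by positivity) z.dirichlet_nonneg, e, mul_left_comm]
    exact mul_lt_mul_of_pos_left hκ (by positivity)
  set k := b / √φ.mass
  have hk : 0 < k := by positivity
  -- Spreading φ out by 1/s at fixed mass multiplies its Dirichlet integral by s², so the strict
  -- inequality survives for small s.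
  have hlim : Tendsto (fun s : ℝ => κ * (v.dirichlet + k ^ 2 * s ^ 2 * φ.dirichlet) ^ (critExp N / 2))
      (𝓝[>] 0) (𝓝 (κ * v.dirichlet ^ (critExp N / 2))) := by
    have hcont : Continuous fun s : ℝ =>
        κ * (v.dirichlet + k ^ 2 * s ^ 2 * φ.dirichlet) ^ (critExp N / 2) :=
      continuous_const.mul ((by fun_prop : Continuous fun s : ℝ =>
        v.dirichlet + k ^ 2 * s ^ 2 * φ.dirichlet).rpow_const fun _ => Or.inr (by positivity))
    have := (hcont.tendsto 0).mono_left (nhdsWithin_le_nhds (s := Set.Ioi 0))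
    simpa using this
  -- The spread profile lives at radii at least 1/s > |R| + 1, outside the ball of radius R
  -- containing the support of z.
  obtain ⟨s, ⟨hs1, hs2⟩, hs0⟩ := ((hlim.eventually_lt_const hvκ).and
    (nhdsWithin_le_nhds (eventually_lt_nhds (show (0 : ℝ) < 1 / (|R| + 1) by positivity)))
    |>.and self_mem_nhdsWithin).exists
  have hs0 : 0 < s := hs0
  have hpow : (s ^ ((N : ℝ) / 2)) ^ 2 = s ^ (N : ℝ) := by
    rw [← Real.rpow_two, ← Real.rpow_mul hs0.le]
    congr 1
    ring
  set w := φ.rescale (k * s ^ ((N : ℝ) / 2)) s hs0 with hw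
  have hwm : w.mass = b ^ 2 := by
    rw [hw, mass_rescale, mul_pow, hpow, mul_assoc (k ^ 2), ← Real.rpow_add hs0, div_pow,
      Real.sq_sqrt hφm.le]
    simp [hφm.ne']
  have hwd : w.dirichlet = k ^ 2 * s ^ 2 * φ.dirichlet := by
    rw [hw, dirichlet_rescale, mul_pow, hpow, mul_assoc (k ^ 2), ← Real.rpow_add hs0]
    simp
  have hwc : 0 < w.critical := by
    rw [hw, critical_rescale]
    positivity
  refine ⟨v, w, hvm, hwm, by rw [hvc]; positivity, hwc, fun x => ?_, ?_⟩
  · by_contra! hx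
    have h1 : z x ≠ 0 := fun h0 => hx.1 (by simp [hv, rescale, h0])
    have h2 : φ (s • x) ≠ 0 := fun h0 => hx.2 (by simp [hw, rescale, h0])
    have h3 := hφs _ h2
    have h4 := hR (subset_tsupport _ (Function.mem_support.2 h1))
    rw [mem_ball_zero_iff] at h4
    rw [norm_smul, Real.norm_eq_abs, abs_of_pos hs0] at h3
    rw [lt_div_iff₀ (by positivity)] at hs2
    have h5 : s * ‖x‖ ≤ s * (|R| + 1) :=
      mul_le_mul_of_nonneg_left (by linarith [le_abs_self R]) hs0.le
    linarith
  · rw [hwd]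
    linarith

end SobolevH1

/-! ### Exponent arithmetic -/

theorem critExp_gt_two {N : ℕ} (hN : 2 < N) : 2 < critExp N := by
  have : (2 : ℝ) < N := by exact_mod_cast hN
  rw [critExp, lt_div_iff₀ (by linarith)]
  linarith

theorem one_div_critExp {N : ℕ} (hN : 2 < N) : 1 / critExp N = 1 / 2 - 1 / N := by
  have : (2 : ℝ) < N := by exact_mod_cast hN
  have : (N : ℝ) - 2 ≠ 0 := by linarith
  rw [critExp]
  field_simp

/-- The left side is the power of r by which the dilation r^{N/2} u(r x) scales the critical
integral; it is also γ at 2*. -/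
theorem half_mul_critExp {N : ℕ} (hN : 2 < N) : (N : ℝ) / 2 * critExp N - N = critExp N := by
  have : (2 : ℝ) < N := by exact_mod_cast hN
  have : (N : ℝ) - 2 ≠ 0 := by linarith
  rw [critExp]
  field_simp
  ring

theorem gammaExp_lt_critExp {N : ℕ} (hN : 2 < N) {p : ℝ} (hp : p < critExp N) :
    gammaExp N p < critExp N := by
  have h : (2 : ℝ) < N := by exact_mod_cast hN
  have := half_mul_critExp hN
  have h2 : (N : ℝ) / 2 * p < N / 2 * critExp N := mul_lt_mul_of_pos_left hp (by linarith)
  rw [gammaExp]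
  linarith

/-- Write t^q = t · t^{q-1} and enlarge both second factors to (x + y)^{q-1}. -/
theorem rpow_add_rpow_lt_add_rpow {x y q : ℝ} (hx : 0 < x) (hy : 0 < y) (hq : 1 < q) :
    x ^ q + y ^ q < (x + y) ^ q := by
  have hq' : q = 1 + (q - 1) := by ring
  have h1 : x ^ (q - 1) < (x + y) ^ (q - 1) :=
    Real.rpow_lt_rpow hx.le (by linarith) (by linarith)
  have h2 : y ^ (q - 1) < (x + y) ^ (q - 1) :=
    Real.rpow_lt_rpow hy.le (by linarith) (by linarith)
  rw [hq', Real.rpow_add hx, Real.rpow_add hy, Real.rpow_add (by linarith), Real.rpow_one,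
    Real.rpow_one, Real.rpow_one]
  nlinarith

/-! ### Energy comparison on the Pohozaev set -/

section Pairs

variable {N : ℕ} {α β ν a b : ℝ}

theorem integral_grad_sq_pair (w : SobolevH1 N × SobolevH1 N) :
    ∫ x, (‖w.1.grad x‖ ^ 2 + ‖w.2.grad x‖ ^ 2) = w.1.dirichlet + w.2.dirichlet :=
  integral_add w.1.integrable_norm_grad_sq w.2.integrable_norm_grad_sq

theorem integral_critical_pair (w : SobolevH1 N × SobolevH1 N)
    (h1 : Integrable fun x => |w.1 x| ^ critExp N) (h2 : Integrable fun x => |w.2 x| ^ critExp N) :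
    ∫ x, (|w.1 x| ^ critExp N + |w.2 x| ^ critExp N) = w.1.critical + w.2.critical :=
  integral_add h1 h2

theorem integrable_critical_pair (w : SobolevH1 N × SobolevH1 N)
    (h : 0 < ∫ x, (|w.1 x| ^ critExp N + |w.2 x| ^ critExp N)) :
    (Integrable fun x => |w.1 x| ^ critExp N) ∧ Integrable fun x => |w.2 x| ^ critExp N := by
  have hi : Integrable fun x => |w.1 x| ^ critExp N + |w.2 x| ^ critExp N := by
    by_contra hn
    exact h.ne' (integral_undef hn)
  constructor
  · refine hi.mono' (w.1.aestronglyMeasurable_abs_rpow _) (Eventually.of_forall fun x => ?_)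
    rw [Real.norm_eq_abs, abs_of_nonneg (by positivity)]
    exact le_add_of_nonneg_right (by positivity)
  · refine hi.mono' (w.2.aestronglyMeasurable_abs_rpow _) (Eventually.of_forall fun x => ?_)
    rw [Real.norm_eq_abs, abs_of_nonneg (by positivity)]
    exact le_add_of_nonneg_left (by positivity)

theorem coupling_nonneg (α β : ℝ) (w : SobolevH1 N × SobolevH1 N) :
    0 ≤ ∫ x, |w.1 x| ^ α * |w.2 x| ^ β :=
  integral_nonneg fun _ => by positivity

/-- On the Pohozaev set the critical integral dominates the Dirichlet integral, and the energy
is at least `1 / N` times the latter. -/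
theorem dirichlet_le_of_mem_pohozaevSet (hN : 2 < N) (hν : ν ≤ 0) (h2 : 2 < α + β)
    (hαβ : α + β < critExp N) {w : SobolevH1 N × SobolevH1 N}
    (hw : w ∈ pohozaevSet N α β ν a b) :
    w.1.dirichlet + w.2.dirichlet ≤ ∫ x, (|w.1 x| ^ critExp N + |w.2 x| ^ critExp N) ∧
      (w.1.dirichlet + w.2.dirichlet) / N ≤ energy α β ν w := by
  have hP := hw.2
  have hB := coupling_nonneg α β w
  have hp := critExp_gt_two hN
  have hN' : (2 : ℝ) < N := by exact_mod_cast hN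
  have hγ : 0 ≤ gammaExp N (α + β) := by
    rw [gammaExp]
    have : 0 < α + β - 2 := by linarith
    positivity
  have hγp : gammaExp N (α + β) / critExp N ≤ 1 := by
    rw [div_le_one (by linarith)]
    exact (gammaExp_lt_critExp hN hαβ).le
  rw [pohozaev, integral_grad_sq_pair] at hP
  rw [energy, integral_grad_sq_pair, one_div_critExp hN]
  have hinv := one_div_critExp hN
  generalize (∫ x, |w.1 x| ^ α * |w.2 x| ^ β) = B at *
  generalize (∫ x, (|w.1 x| ^ critExp N + |w.2 x| ^ critExp N)) = C at *
  generalize w.1.dirichlet + w.2.dirichlet = D at *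
  generalize gammaExp N (α + β) = γ at *
  have h0 : 0 ≤ -ν * γ * B := mul_nonneg (mul_nonneg (by linarith) hγ) hB
  refine ⟨by linarith, ?_⟩
  -- Eliminating C by the constraint makes this quantity exactly the energy minus D/N.
  have h3 : 0 ≤ -ν * B * (1 - γ / critExp N) :=
    mul_nonneg (mul_nonneg (by linarith) hB) (by linarith)
  rw [div_eq_mul_one_div γ, hinv] at h3
  have hC : C = D - ν * γ * B := by linarith
  rw [hC]
  have : D / N = D * (1 / N) := by rw [mul_one_div]
  rw [this]
  linear_combination h3

theorem energy_of_disjoint (hN : 2 < N) (hα : 0 < α) (hβ : 0 < β)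
    {w : SobolevH1 N × SobolevH1 N} (hw : ∀ x, w.1 x = 0 ∨ w.2 x = 0)
    (h1 : 0 < w.1.critical) (h2 : 0 < w.2.critical)
    (h : w.1.dirichlet + w.2.dirichlet = w.1.critical + w.2.critical) :
    pohozaev α β ν w = 0 ∧ energy α β ν w = (w.1.dirichlet + w.2.dirichlet) / N := by
  have hB : ∫ x, |w.1 x| ^ α * |w.2 x| ^ β = 0 := by
    refine integral_eq_zero_of_ae (Eventually.of_forall fun x => ?_)
    rcases hw x with h | h <;> simp [h, hα.ne', hβ.ne']
  rw [pohozaev, energy, hB, integral_grad_sq_pair, integral_critical_pair w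
    (w.1.integrable_of_critical_pos h1) (w.2.integrable_of_critical_pos h2), one_div_critExp hN, ← h]
  constructor <;> ring

/-- A single function with `κ D^q < C` yields an element of the Pohozaev set with `κ D^q < D`
and energy `D / N`. -/
theorem exists_mem_pohozaevSet (hN : 2 < N) (hα : 0 < α) (hβ : 0 < β) (ν : ℝ) (ha : 0 < a)
    (hb : 0 < b) {κ : ℝ} (u : SobolevH1 N) (hu : 0 < u.critical)
    (h : κ * u.dirichlet ^ (critExp N / 2) < u.critical) :
    ∃ w ∈ pohozaevSet N α β ν a b, ∃ D : ℝ, energy α β ν w = D / N ∧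
      κ * D ^ (critExp N / 2) < D := by
  have hp := critExp_gt_two hN
  obtain ⟨v, w, hvm, hwm, hv, hw, hvw, hκ⟩ :=
    u.exists_disjoint_pair (by omega) (by linarith) ha hb hu h
  have hD : 0 < v.dirichlet + w.dirichlet :=
    add_pos (v.dirichlet_pos (by omega) (by rw [hvm]; positivity))
      (w.dirichlet_pos (by omega) (by rw [hwm]; positivity))
  -- The mass-preserving dilation multiplies D by r² and C by r^{2*}; this r makes the two equal.
  set r := ((v.dirichlet + w.dirichlet) / (v.critical + w.critical)) ^ (1 / (critExp N - 2))
    with hr_def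
  have hr : 0 < r := by positivity
  have hrp : r ^ critExp N * (v.critical + w.critical) = r ^ 2 * (v.dirichlet + w.dirichlet) := by
    have e : r ^ (critExp N - 2) = (v.dirichlet + w.dirichlet) / (v.critical + w.critical) := by
      rw [hr_def, ← Real.rpow_mul (by positivity), one_div_mul_cancel (by linarith), Real.rpow_one]
    have e2 : r ^ critExp N = r ^ 2 * r ^ (critExp N - 2) := by
      rw [← Real.rpow_two, ← Real.rpow_add hr]
      congr 1
      ring
    rw [e2, e]
    field_simp
  have hc2 : (r ^ ((N : ℝ) / 2)) ^ 2 = r ^ (N : ℝ) := by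
    rw [← Real.rpow_two, ← Real.rpow_mul hr.le]
    congr 1
    ring
  have hm : ∀ z : SobolevH1 N, (z.rescale (r ^ ((N : ℝ) / 2)) r hr).mass = z.mass := fun z => by
    rw [SobolevH1.mass_rescale, hc2, ← Real.rpow_add hr]
    simp
  have hd : ∀ z : SobolevH1 N,
      (z.rescale (r ^ ((N : ℝ) / 2)) r hr).dirichlet = r ^ 2 * z.dirichlet := fun z => by
    rw [SobolevH1.dirichlet_rescale, hc2, ← Real.rpow_add hr]
    simp
  have hcr : ∀ z : SobolevH1 N,
      (z.rescale (r ^ ((N : ℝ) / 2)) r hr).critical = r ^ critExp N * z.critical := fun z => by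
    rw [SobolevH1.critical_rescale, abs_of_pos (by positivity), ← Real.rpow_mul hr.le,
      ← Real.rpow_add hr, ← sub_eq_add_neg, half_mul_critExp hN]
  obtain ⟨hP, hE⟩ := energy_of_disjoint (ν := ν) hN hα hβ
    (w := (v.rescale (r ^ ((N : ℝ) / 2)) r hr, w.rescale (r ^ ((N : ℝ) / 2)) r hr))
    (fun x => (hvw (r • x)).imp (fun h => by simp [SobolevH1.rescale, h])
      fun h => by simp [SobolevH1.rescale, h])
    (by simp only [hcr]; positivity) (by simp only [hcr]; positivity)
    (by simp only [hcr, hd, ← mul_add, hrp])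
  refine ⟨(v.rescale (r ^ ((N : ℝ) / 2)) r hr, w.rescale (r ^ ((N : ℝ) / 2)) r hr),
    ⟨⟨(hm v).trans hvm, (hm w).trans hwm⟩, hP⟩, _, hE, ?_⟩
  have e : (r ^ 2) ^ (critExp N / 2) = r ^ critExp N := by
    rw [← Real.rpow_two, ← Real.rpow_mul hr.le]
    congr 1
    ring
  simp only [hd, ← mul_add]
  rw [← hrp, hrp, Real.mul_rpow (by positivity) hD.le, e, mul_left_comm, ← hrp]
  exact mul_lt_mul_of_pos_left hκ (by positivity)

/-- No element of the Pohozaev set has least energy. -/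
theorem exists_energy_lt (hN : 2 < N) (hα : 1 < α) (hβ : 1 < β) (hαβ : α + β < critExp N)
    (hν : ν ≤ 0) (ha : 0 < a) (hb : 0 < b) {w : SobolevH1 N × SobolevH1 N}
    (hw : w ∈ pohozaevSet N α β ν a b) :
    ∃ w' ∈ pohozaevSet N α β ν a b, energy α β ν w' < energy α β ν w := by
  have hp := critExp_gt_two hN
  have hq : 1 < critExp N / 2 := by linarith
  obtain ⟨hDC, hE⟩ := dirichlet_le_of_mem_pohozaevSet hN hν (by linarith) hαβ hw
  have hD1 : 0 < w.1.dirichlet :=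
    w.1.dirichlet_pos (by omega) ((pow_pos ha 2).trans_eq hw.1.1.symm)
  have hD2 : 0 < w.2.dirichlet :=
    w.2.dirichlet_pos (by omega) ((pow_pos hb 2).trans_eq hw.1.2.symm)
  obtain ⟨hi1, hi2⟩ := integrable_critical_pair w (by linarith)
  rw [integral_critical_pair w hi1 hi2] at hDC
  set D := w.1.dirichlet + w.2.dirichlet
  set C := w.1.critical + w.2.critical with hC
  have hD : 0 < D := add_pos hD1 hD2
  have hC0 : 0 < C := by linarith
  set κ := C / D ^ (critExp N / 2) with hκ
  have hκ0 : 0 < κ := by positivity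
  -- Otherwise C ≤ κ(D₁^q + D₂^q) < κ D^q = C for the two components of w.
  obtain ⟨z, hz⟩ : ∃ z : SobolevH1 N, κ * z.dirichlet ^ (critExp N / 2) < z.critical := by
    by_contra! hn
    have h1 := mul_lt_mul_of_pos_left (rpow_add_rpow_lt_add_rpow hD1 hD2 hq) hκ0
    have h2 : κ * D ^ (critExp N / 2) = C := div_mul_cancel₀ _ (by positivity)
    linarith [hn w.1, hn w.2]
  obtain ⟨w', hw', D', hE', hD'⟩ := exists_mem_pohozaevSet hN (zero_lt_one.trans hα)
    (zero_lt_one.trans hβ) ν ha hb z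
    (lt_of_le_of_lt (mul_nonneg hκ0.le (Real.rpow_nonneg z.dirichlet_nonneg _)) hz) hz
  refine ⟨w', hw', ?_⟩
  rw [hE']
  refine lt_of_lt_of_le (div_lt_div_of_pos_right ?_ (by positivity)) hE
  -- If D ≤ D', then κ D'^q = C (D'/D)^q ≥ C D'/D ≥ D', against κ D'^q < D'.
  by_contra! hle
  have h1 : D' / D ≤ (D' / D) ^ (critExp N / 2) :=
    Real.self_le_rpow_of_one_le ((one_le_div hD).2 hle) hq.le
  have h2 : κ * D' ^ (critExp N / 2) = C * (D' / D) ^ (critExp N / 2) := by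
    rw [hκ, Real.div_rpow (by linarith) hD.le]
    ring
  have h3 : D' ≤ C * (D' / D) := by
    rw [mul_div_assoc', le_div_iff₀ hD, mul_comm]
    exact mul_le_mul_of_nonneg_right hDC (by linarith)
  have h4 := mul_le_mul_of_nonneg_left h1 hC0.le
  linarith

end Pairs

theorem theorem1p1 (N : ℕ) (hN : N = 3 ∨ N = 4) (a b : ℝ) (ha : 0 < a) (hb : 0 < b)
    (α β : ℝ) (hα : 1 < α) (hβ : 1 < β) (hαβ : α + β < critExp N) (ν : ℝ) (hν : ν ≤ 0) :
    (pohozaevSet N α β ν a b).Nonempty ∧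
    BddBelow (energy α β ν '' pohozaevSet N α β ν a b) ∧
    (¬ ∃ w ∈ pohozaevSet N α β ν a b, energy α β ν w = groundLevel N α β ν a b) ∧
    (¬ ∃ w : SobolevH1 N × SobolevH1 N, IsNormalizedGroundState α β ν a b w) := by

  have hN2 : 2 < N := by omega
  have hp := critExp_gt_two hN2
  have hbdd : BddBelow (energy α β ν '' pohozaevSet N α β ν a b) := by
    refine ⟨0, ?_⟩
    rintro _ ⟨w, hw, rfl⟩
    refine le_trans ?_ (dirichlet_le_of_mem_pohozaevSet hN2 hν (by linarith) hαβ hw).2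
    exact div_nonneg (add_nonneg w.1.dirichlet_nonneg w.2.dirichlet_nonneg) (Nat.cast_nonneg _)
  have hnot : ¬ ∃ w ∈ pohozaevSet N α β ν a b, energy α β ν w = groundLevel N α β ν a b := by
    rintro ⟨w, hw, he⟩
    obtain ⟨w', hw', hlt⟩ := exists_energy_lt hN2 hα hβ hαβ hν ha hb hw
    have : groundLevel N α β ν a b ≤ energy α β ν w' := csInf_le hbdd ⟨w', hw', rfl⟩
    linarith
  refine ⟨?_, hbdd, hnot, fun ⟨w, hw, _, he⟩ => hnot ⟨w, hw, he⟩⟩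
  obtain ⟨φ, hφ, -⟩ := SobolevH1.exists_critical_pos_support (N := N) (by omega) (by linarith)
  -- With κ = 0 the required inequality is mere positivity of the critical integral, so any
  -- nontrivial bump proves nonemptiness.
  obtain ⟨w, hw, -⟩ := exists_mem_pohozaevSet (κ := 0) hN2 (zero_lt_one.trans hα)
    (zero_lt_one.trans hβ) ν ha hb φ hφ
    (by simpa using hφ)
  exact ⟨w, hw⟩
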